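/- Let $1\le p\le\infty$ and let $(\mathcal X_i,d_i)$, $i=1,\dots,K$, be Polish metric spaces. Equip $\mathcal Z=\mathcal X_1\times\dots\times\mathcal X_K$ with the metric $d_{\mathcal Z,p}(\boldsymbol x,\boldsymbol z)=\bigl(\sum_{i=1}^K d_i(x_i,z_i)^p\bigr)^{1/p}$ if $p<\infty$ and $d_{\mathcal Z,\infty}(\boldsymbol x,\boldsymbol z)=\max_i d_i(x_i,z_i)$. For Borel probability measures $\mu,\nu$ on a metric space $(S,d)$ let $W_p(\mu,\nu)=\inf_\gamma\bigl(\int d(x,y)^p\,d\gamma(x,y)\bigr)^{1/p}\in[0,\infty]$ if $p<\infty$ and $W_\infty(\mu,\nu)=\inf_\gamma\operatorname{ess\,sup}_\gamma d(x,y)$, the infimum being over all couplings $\gamma$ of $\mu$ and $\nu$. On $\mathcal X_i$ this is taken with respect to $d_i$ and written $W_p$; on $\mathcal Z$ it is taken with respect to $d_{\mathcal Z,p}$ and written $\mathcal W_p$. For vectors of probability measures $\boldsymbol\mu=(\mu^1,\dots,\mu^K)$ and $\boldsymbol\nu=(\nu^1,\dots,\nu^K)$ with $\mu^i,\nu^i$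 on $\mathcal X_i$, put $W_p(\boldsymbol\mu,\boldsymbol\nu)=\bigl(\sum_{i=1}^K W_p(\mu^i,\nu^i)^p\bigr)^{1/p}$ if $p<\infty$ and $W_\infty(\boldsymbol\mu,\boldsymbol\nu)=\max_i W_\infty(\mu^i,\nu^i)$, and let $\Pi(\boldsymbol\mu)$ be the set of probability measures on $\mathcal Z$ with marginals $\mu^1,\dots,\mu^K$. Let $\pi^0\in\Pi(\boldsymbol\mu)$ and $m,n\ge1$. Let $\pi^0_m=\frac1m\sum_{j=1}^m\delta_{\boldsymbol Z_j}$ be the empirical measure of the coupled data $\boldsymbol Z_1,\dots,\boldsymbol Z_m\in\mathcal Z$, let $\boldsymbol\nu_m=(\nu_m^1,\dots,\nu_m^K)$ be the vector of its marginals, and let $\boldsymbol\mu_n=(\mu_n^1,\dots,\mu_n^K)$ with $\mu^i_n=\frac1n\sum_{j=1}^n\delta_{X_{ij}}$ be the vector of empirical measures of the marginal data $X_{i1},\dots,X_{in}\in\mathcal X_i$. (The data are arbitrary points; in particular the result applies to every realization of samples drawn i.i.d. from $\pi^0$ and from the $\mu^i$.) Let $\hat\pi$ be any $\mathcal W_p$-projection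 of $\pi^0_m$ onto $\Pi(\boldsymbol\mu_n)$, that is, $\hat\pi\in\Pi(\boldsymbol\mu_n)$ and $\mathcal W_p(\hat\pi,\pi^0_m)\le\mathcal W_p(\pi',\pi^0_m)$ for all $\pi'\in\Pi(\boldsymbol\mu_n)$. Then $$W_p(\boldsymbol\mu,\boldsymbol\mu_n)\le\mathcal W_p(\hat\pi,\pi^0)\le W_p(\boldsymbol\mu_n,\boldsymbol\nu_m)+\mathcal W_p(\pi^0_m,\pi^0).$$ Moreover, the projection distance is given by $\mathcal W_p(\hat\pi,\pi^0_m)=W_p(\boldsymbol\mu_n,\boldsymbol\nu_m)$. -/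

import Mathlib

open MeasureTheory
open scoped ENNReal

noncomputable section

/-- `Π(μ, ν)`: the probability measures on `S × S` with first marginal `μ` and second
marginal `ν`. -/
def pairCouplings {S : Type*} [MeasurableSpace S] (μ ν : Measure S) : Set (Measure (S × S)) :=
  {γ | IsProbabilityMeasure γ ∧ γ.map Prod.fst = μ ∧ γ.map Prod.snd = ν}

/-- The `p`-Wasserstein distance between `μ` and `ν` for the (extended real valued) distance
function `d`, with values in `[0, ∞]`. For `1 ≤ p < ∞`, `eLpNorm f p γ` is
`(∫ f ^ p dγ) ^ (1 / p)`; for `p = ∞` it is the `γ`-essential supremum of `f`. -/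
def wassersteinWith {S : Type*} [MeasurableSpace S] (d : S → S → ℝ≥0∞) (p : ℝ≥0∞)
    (μ ν : Measure S) : ℝ≥0∞ :=
  ⨅ γ ∈ pairCouplings μ ν, eLpNorm (fun q : S × S => d q.1 q.2) p γ

/-- `W_p(μ, ν)` on a metric space. -/
def wasserstein {S : Type*} [MetricSpace S] [MeasurableSpace S] (p : ℝ≥0∞)
    (μ ν : Measure S) : ℝ≥0∞ :=
  wassersteinWith (fun x y : S => edist x y) p μ ν

/-- The `ℓ^p` combination of `K` numbers in `[0, ∞]`: `(∑ i, a i ^ p) ^ (1 / p)` for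
`1 ≤ p < ∞` and `max_i a i` for `p = ∞`. -/
def lpCombine {K : ℕ} (p : ℝ≥0∞) (a : Fin K → ℝ≥0∞) : ℝ≥0∞ :=
  if p = ∞ then ⨆ i, a i else (∑ i, a i ^ p.toReal) ^ (1 / p.toReal)

/-- The separable product metric `d_{Z,p}` on `Z = X_1 × ... × X_K`. -/
def prodDist {K : ℕ} {X : Fin K → Type*} [∀ i, MetricSpace (X i)] (p : ℝ≥0∞)
    (x z : ∀ i, X i) : ℝ≥0∞ :=
  lpCombine p fun i => edist (x i) (z i)

/-- The `p`-Wasserstein distance on the product space `Z`, with respect to `d_{Z,p}`. -/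
def prodWasserstein {K : ℕ} {X : Fin K → Type*} [∀ i, MetricSpace (X i)]
    [∀ i, MeasurableSpace (X i)] (p : ℝ≥0∞) (π π' : Measure (∀ i, X i)) : ℝ≥0∞ :=
  wassersteinWith (prodDist p) p π π'

/-- The distance `W_p(μ, ν)` between two vectors of marginals. -/
def vecWasserstein {K : ℕ} {X : Fin K → Type*} [∀ i, MetricSpace (X i)]
    [∀ i, MeasurableSpace (X i)] (p : ℝ≥0∞) (μ ν : ∀ i, Measure (X i)) : ℝ≥0∞ :=
  lpCombine p fun i => wasserstein p (μ i) (ν i)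

/-- The vector of the marginals of a measure on `Z`. -/
def marginals {K : ℕ} {X : Fin K → Type*} [∀ i, MeasurableSpace (X i)]
    (π : Measure (∀ i, X i)) : ∀ i, Measure (X i) :=
  fun i => π.map fun x => x i

/-- `Π(μ^1, ..., μ^K)`: the probability measures on `Z` with marginals `μ^1, ..., μ^K`. -/
def multiCouplings {K : ℕ} {X : Fin K → Type*} [∀ i, MeasurableSpace (X i)]
    (μ : ∀ i, Measure (X i)) : Set (Measure (∀ i, X i)) :=
  {π | IsProbabilityMeasure π ∧ marginals π = μ}

/-- The empirical measure `(1 / n) ∑ j, δ_{x_j}`. -/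
def empirical {S : Type*} [MeasurableSpace S] {n : ℕ} (x : Fin n → S) : Measure S :=
  (n : ℝ≥0∞)⁻¹ • ∑ j, Measure.dirac (x j)

/-- `πhat` is a `W_p`-projection of `π` onto `Π(μ)`: a minimizer of `π' ↦ W_p(π', π)` over
`π' ∈ Π(μ)`. -/
def IsProjection {K : ℕ} {X : Fin K → Type*} [∀ i, MetricSpace (X i)]
    [∀ i, MeasurableSpace (X i)] (p : ℝ≥0∞) (π : Measure (∀ i, X i))
    (μ : ∀ i, Measure (X i)) (πhat : Measure (∀ i, X i)) : Prop :=
  πhat ∈ multiCouplings μ ∧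
    ∀ π' ∈ multiCouplings μ, prodWasserstein p πhat π ≤ prodWasserstein p π' π

end

open ProbabilityTheory Filter Topology

/-! ### ℓ^p combinations of extended nonnegative numbers -/

section LpCombine

variable {K : ℕ} {p : ℝ≥0∞}

/-! The cost on the product space separates: the cost of a coupling is the ℓ^p combination of the
costs of its coordinate couplings (`eLpNorm_prodDist`). Hence passing to marginals never increases
the distance (`vecWasserstein_marginals_le`), which yields both lower bounds.

Conversely, any coordinate couplings with the marginals of an empirical measure come from one
coupling on the product space (`exists_lift_coupling`): keep the data points intact and, given a
data point, draw the coordinates independently from the conditional laws. Nearly optimal coordinate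
couplings thus give competitors for the projection, which determines its distance exactly. The
remaining upper bound is the triangle inequality, by gluing. -/

theorem lpCombine_mono {a b : Fin K → ℝ≥0∞} (h : ∀ i, a i ≤ b i) :
    lpCombine p a ≤ lpCombine p b := by
  unfold lpCombine
  split_ifs
  · exact iSup_mono h
  · gcongr with i
    exact h i

theorem lpCombine_add_le (hp : 1 ≤ p) (a b : Fin K → ℝ≥0∞) :
    lpCombine p (fun i => a i + b i) ≤ lpCombine p a + lpCombine p b := by
  unfold lpCombine
  split_ifs with h
  · exact iSup_le fun i => add_le_add (le_iSup a i) (le_iSup b i)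
  · exact ENNReal.Lp_add_le _ _ _ (by simpa using ENNReal.toReal_mono h hp)

theorem continuous_lpCombine : Continuous (lpCombine (K := K) p) := by
  unfold lpCombine
  split_ifs
  · simp_rw [← Finset.sup_univ_eq_iSup]
    exact Continuous.finset_sup_apply fun i _ => continuous_apply i
  · refine ENNReal.continuous_rpow_const.comp (continuous_finsetSum _ fun i _ => ?_)
    exact ENNReal.continuous_rpow_const.comp (continuous_apply i)

/-- For finite `p` a finite sum commutes with the integral; for `p = ∞` finitely many almost sure
bounds hold simultaneously. -/
theorem eLpNorm_lpCombine (hp : 1 ≤ p) {Ω : Type*} [MeasurableSpace Ω] {γ : Measure Ω}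
    {f : Fin K → Ω → ℝ≥0∞} (hf : ∀ i, Measurable (f i)) :
    eLpNorm (fun ω => lpCombine p fun i => f i ω) p γ =
      lpCombine p fun i => eLpNorm (f i) p γ := by
  by_cases h : p = ∞
  · subst h
    simp only [lpCombine, if_true, eLpNorm_exponent_top]
    refine le_antisymm ?_ (iSup_le fun i => ?_)
    · refine essSup_le_of_ae_le _ ?_
      filter_upwards [ae_all_iff.2 fun i => ae_le_eLpNormEssSup (f := f i) (μ := γ)] with ω hω
      exact iSup_mono hω
    · refine essSup_mono_ae (Eventually.of_forall fun ω => ?_)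
      exact le_iSup (fun i => f i ω) i
  · have h0 : p ≠ 0 := (zero_lt_one.trans_le hp).ne'
    have hr : p.toReal ≠ 0 := (ENNReal.toReal_pos h0 h).ne'
    simp only [lpCombine, if_neg h, eLpNorm_eq_lintegral_rpow_enorm_toReal h0 h, enorm_eq_self,
      one_div, ENNReal.rpow_inv_rpow hr]
    rw [lintegral_finsetSum _ fun i _ => (hf i).pow_const _]

end LpCombine

/-! ### Couplings, gluing and the triangle inequality -/

section Wasserstein

variable {S : Type*} [MeasurableSpace S]

theorem map_mem_pairCouplings {T : Type*} [MeasurableSpace T] {γ : Measure (S × S)}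
    {μ ν : Measure S} (hγ : γ ∈ pairCouplings μ ν) {f : S → T} (hf : Measurable f) :
    γ.map (Prod.map f f) ∈ pairCouplings (μ.map f) (ν.map f) := by
  obtain ⟨h, rfl, rfl⟩ := hγ
  refine ⟨Measure.isProbabilityMeasure_map (by fun_prop), ?_, ?_⟩ <;>
  · rw [Measure.map_map (by fun_prop) (by fun_prop), Measure.map_map (by fun_prop) (by fun_prop)]
    rfl

theorem swap_mem_pairCouplings {γ : Measure (S × S)} {μ ν : Measure S}
    (hγ : γ ∈ pairCouplings μ ν) : γ.map Prod.swap ∈ pairCouplings ν μ := by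
  obtain ⟨h, rfl, rfl⟩ := hγ
  refine ⟨Measure.isProbabilityMeasure_map (by fun_prop), ?_, ?_⟩ <;>
  · rw [Measure.map_map (by fun_prop) (by fun_prop)]
    rfl

theorem prod_mem_pairCouplings (μ ν : Measure S) [IsProbabilityMeasure μ]
    [IsProbabilityMeasure ν] : μ.prod ν ∈ pairCouplings μ ν :=
  ⟨inferInstance, by simp, by simp⟩

theorem wassersteinWith_le {d : S → S → ℝ≥0∞} {p : ℝ≥0∞} {μ ν : Measure S}
    {γ : Measure (S × S)} (hγ : γ ∈ pairCouplings μ ν) :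
    wassersteinWith d p μ ν ≤ eLpNorm (fun q : S × S => d q.1 q.2) p γ :=
  iInf₂_le γ hγ

theorem wassersteinWith_comm {d : S → S → ℝ≥0∞} (hd : Measurable fun q : S × S => d q.1 q.2)
    (hsymm : ∀ x y, d x y = d y x) (p : ℝ≥0∞) (μ ν : Measure S) :
    wassersteinWith d p μ ν = wassersteinWith d p ν μ := by
  have key : ∀ μ ν : Measure S, wassersteinWith d p μ ν ≤ wassersteinWith d p ν μ := by
    refine fun μ ν => le_iInf₂ fun γ hγ => (wassersteinWith_le (swap_mem_pairCouplings hγ)).trans ?_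
    rw [eLpNorm_map_measure hd.aestronglyMeasurable measurable_swap.aemeasurable]
    exact (congrArg (eLpNorm · p γ) (funext fun q => hsymm q.2 q.1)).le
  exact le_antisymm (key μ ν) (key ν μ)

/-- Two couplings with a common marginal are the two-dimensional marginals of one measure. -/
theorem exists_gluing [StandardBorelSpace S] {μ ν ρ : Measure S} {γ₁ γ₂ : Measure (S × S)}
    (h₁ : γ₁ ∈ pairCouplings μ ν) (h₂ : γ₂ ∈ pairCouplings ν ρ) :
    ∃ Γ : Measure (S × S × S), IsProbabilityMeasure Γ ∧
      Γ.map (fun q => (q.2.1, q.1)) = γ₁ ∧ Γ.map (fun q => (q.1, q.2.2)) = γ₂ := by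
  obtain ⟨_, h₁f, h₁s⟩ := h₁
  obtain ⟨_, h₂f, h₂s⟩ := h₂
  have : IsProbabilityMeasure ν := h₂f ▸ Measure.isProbabilityMeasure_map (by fun_prop)
  have : Nonempty S := nonempty_of_isProbabilityMeasure ν
  have hσ : IsProbabilityMeasure (γ₁.map Prod.swap) :=
    Measure.isProbabilityMeasure_map (by fun_prop)
  have hfst : (γ₁.map Prod.swap).fst = ν := by
    rw [Measure.fst, Measure.map_map (by fun_prop) (by fun_prop), ← h₁s]
    rfl
  have hd₁ := (γ₁.map Prod.swap).disintegrate (γ₁.map Prod.swap).condKernel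
  have hd₂ := γ₂.disintegrate γ₂.condKernel
  rw [hfst] at hd₁
  rw [Measure.fst, h₂f] at hd₂
  -- The common marginal `ν` is the first coordinate; given it, the two outer points are
  -- conditionally independent.
  refine ⟨ν ⊗ₘ ((γ₁.map Prod.swap).condKernel ×ₖ γ₂.condKernel), inferInstance, ?_, ?_⟩
  · have : (fun q : S × S × S => (q.2.1, q.1)) = Prod.swap ∘ Prod.map id Prod.fst := rfl
    rw [this, ← Measure.map_map (by fun_prop) (by fun_prop), ← Measure.compProd_map (by fun_prop),
      ← Kernel.fst_eq, Kernel.fst_prod, hd₁, Measure.map_map (by fun_prop) (by fun_prop)]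
    simp
  · have : (fun q : S × S × S => (q.1, q.2.2)) = Prod.map id Prod.snd := rfl
    rw [this, ← Measure.compProd_map (by fun_prop), ← Kernel.snd_eq, Kernel.snd_prod, hd₂]

theorem wassersteinWith_triangle [StandardBorelSpace S] {d : S → S → ℝ≥0∞}
    (hd : Measurable fun q : S × S => d q.1 q.2) (htri : ∀ x y z, d x z ≤ d x y + d y z)
    {p : ℝ≥0∞} (hp : 1 ≤ p) (μ ν ρ : Measure S) :
    wassersteinWith d p μ ρ ≤ wassersteinWith d p μ ν + wassersteinWith d p ν ρ := by
  simp only [wassersteinWith, ENNReal.iInf_add, ENNReal.add_iInf]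
  refine le_iInf₂ fun γ₂ h₂ => le_iInf₂ fun γ₁ h₁ => ?_
  obtain ⟨Γ, hΓ, rfl, rfl⟩ := exists_gluing h₁ h₂
  have hm : Γ.map (fun q => q.2) ∈ pairCouplings μ ρ := by
    obtain ⟨_, rfl, -⟩ := h₁
    obtain ⟨_, -, rfl⟩ := h₂
    refine ⟨Measure.isProbabilityMeasure_map (by fun_prop), ?_, ?_⟩ <;>
    · rw [Measure.map_map (by fun_prop) (by fun_prop), Measure.map_map (by fun_prop) (by fun_prop)]
      rfl
  refine (iInf₂_le _ hm).trans ?_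
  rw [eLpNorm_map_measure hd.aestronglyMeasurable (by fun_prop),
    eLpNorm_map_measure hd.aestronglyMeasurable (by fun_prop),
    eLpNorm_map_measure hd.aestronglyMeasurable (by fun_prop)]
  refine le_trans (eLpNorm_mono_enorm fun q => ?_) (eLpNorm_add_le
    (hd.comp (by fun_prop)).aestronglyMeasurable (hd.comp (by fun_prop)).aestronglyMeasurable hp)
  exact htri _ _ _

/-- Minimizing sequences stand in for optimal couplings, so no existence theorem for minimizers is
needed. -/
theorem exists_seq_tendsto_wassersteinWith (d : S → S → ℝ≥0∞) (p : ℝ≥0∞) (μ ν : Measure S)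
    [IsProbabilityMeasure μ] [IsProbabilityMeasure ν] :
    ∃ γ : ℕ → Measure (S × S), (∀ k, γ k ∈ pairCouplings μ ν) ∧
      Tendsto (fun k => eLpNorm (fun q : S × S => d q.1 q.2) p (γ k)) atTop
        (𝓝 (wassersteinWith d p μ ν)) := by
  obtain ⟨u, -, hu, hmem⟩ := exists_seq_tendsto_sInf
    (S := (fun γ => eLpNorm (fun q : S × S => d q.1 q.2) p γ) '' pairCouplings μ ν)
    ⟨_, _, prod_mem_pairCouplings μ ν, rfl⟩ (OrderBot.bddBelow _)
  choose γ hγ hγu using hmem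
  refine ⟨γ, hγ, ?_⟩
  rw [wassersteinWith, ← sInf_image]
  simpa only [hγu] using hu

end Wasserstein

/-! ### Empirical measures -/

section Empirical

variable {S : Type*} [MeasurableSpace S] {n : ℕ}

theorem isProbabilityMeasure_empirical (hn : 0 < n) (x : Fin n → S) :
    IsProbabilityMeasure (empirical x) := by
  refine ⟨?_⟩
  simp [empirical, ENNReal.inv_mul_cancel (Nat.cast_ne_zero.2 hn.ne') (ENNReal.natCast_ne_top n)]

theorem map_smul_sum {T : Type*} [MeasurableSpace T] (c : ℝ≥0∞) (μ : Fin n → Measure S)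
    {f : S → T} (hf : Measurable f) :
    (c • ∑ j, μ j).map f = c • ∑ j, (μ j).map f := by
  rw [Measure.map_smul, ← Measure.mapₗ_apply_of_measurable hf, map_sum]
  simp_rw [Measure.mapₗ_apply_of_measurable hf]

theorem map_empirical {T : Type*} [MeasurableSpace T] (x : Fin n → S) {f : S → T}
    (hf : Measurable f) : (empirical x).map f = empirical fun j => f (x j) := by
  simp_rw [empirical, map_smul_sum _ _ hf, Measure.map_dirac' hf]

/-- The sum runs over indices, not distinct atoms, so repeated data points need no separate
treatment. -/
theorem empirical_compProd {T : Type*} [MeasurableSpace T] (hn : 0 < n) (x : Fin n → S)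
    (κ : Kernel S T) [IsMarkovKernel κ] :
    empirical x ⊗ₘ κ = (n : ℝ≥0∞)⁻¹ • ∑ j, (κ (x j)).map (Prod.mk (x j)) := by
  have := isProbabilityMeasure_empirical hn x
  ext s hs
  rw [Measure.compProd_apply hs, empirical, lintegral_smul_measure, lintegral_finsetSum_measure]
  simp only [Measure.smul_apply, Measure.finsetSum_apply, smul_eq_mul]
  congr 1
  refine Finset.sum_congr rfl fun j _ => ?_
  rw [lintegral_dirac' _ (Kernel.measurable_kernel_prodMk_left hs),
    Measure.map_apply measurable_prodMk_left hs]

end Empirical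

/-! ### The product space and the projection -/

section Product

variable {K : ℕ} {X : Fin K → Type*} [∀ i, MetricSpace (X i)] {p : ℝ≥0∞}

theorem prodDist_triangle (hp : 1 ≤ p) (x y z : ∀ i, X i) :
    prodDist p x z ≤ prodDist p x y + prodDist p y z :=
  (lpCombine_mono fun i => edist_triangle _ (y i) _).trans (lpCombine_add_le hp _ _)

variable [∀ i, PolishSpace (X i)] [∀ i, MeasurableSpace (X i)] [∀ i, BorelSpace (X i)]

theorem measurable_edist_eval (i : Fin K) :
    Measurable fun q : (∀ i, X i) × (∀ i, X i) => edist (q.1 i) (q.2 i) := by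
  fun_prop

theorem measurable_prodDist :
    Measurable fun q : (∀ i, X i) × (∀ i, X i) => prodDist p q.1 q.2 :=
  continuous_lpCombine.measurable.comp (measurable_pi_lambda _ measurable_edist_eval)

theorem eLpNorm_prodDist (hp : 1 ≤ p) (γ : Measure ((∀ i, X i) × (∀ i, X i))) :
    eLpNorm (fun q : (∀ i, X i) × (∀ i, X i) => prodDist p q.1 q.2) p γ =
      lpCombine p fun i => eLpNorm (fun q : X i × X i => edist q.1 q.2) p
        (γ.map (Prod.map (fun x => x i) (fun x => x i))) := by
  simp only [prodDist]
  rw [eLpNorm_lpCombine hp measurable_edist_eval]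
  congr 1 with i
  rw [eLpNorm_map_measure (by fun_prop) (by fun_prop)]
  rfl

/-- The distance of the marginals is at most the distance on the product space. -/
theorem vecWasserstein_marginals_le (hp : 1 ≤ p) (π π' : Measure (∀ i, X i)) :
    vecWasserstein p (marginals π) (marginals π') ≤ prodWasserstein p π π' := by
  refine le_iInf₂ fun γ hγ => ?_
  rw [eLpNorm_prodDist hp]
  exact lpCombine_mono fun i =>
    wassersteinWith_le (map_mem_pairCouplings hγ (measurable_pi_apply i))

theorem vecWasserstein_comm (p : ℝ≥0∞) (μ ν : ∀ i, Measure (X i)) :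
    vecWasserstein p μ ν = vecWasserstein p ν μ := by
  unfold vecWasserstein wasserstein
  congr 1 with i
  exact wassersteinWith_comm measurable_edist edist_comm p _ _

/-- Couplings of the coordinates with the marginals of an empirical measure lift to a coupling
on the product space. -/
theorem exists_lift_coupling {m : ℕ} (hm : 0 < m) (z : Fin m → ∀ i, X i)
    {ν : ∀ i, Measure (X i)} {γ : ∀ i, Measure (X i × X i)}
    (hγ : ∀ i, γ i ∈ pairCouplings (ν i) (marginals (empirical z) i)) :
    ∃ π ∈ multiCouplings ν, ∃ Γ ∈ pairCouplings π (empirical z),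
      ∀ i, Γ.map (Prod.map (fun x => x i) (fun x => x i)) = γ i := by
  have hne : ∀ i, Nonempty (X i) := fun i => ⟨z ⟨0, hm⟩ i⟩
  have hprob : ∀ i, IsProbabilityMeasure ((γ i).map Prod.swap) := fun i =>
    (swap_mem_pairCouplings (hγ i)).1
  -- The swap puts the data coordinate first, so `κ i` is the conditional law given that coordinate.
  let κ : ∀ i, Kernel (X i) (X i) := fun i => ((γ i).map Prod.swap).condKernel
  have hκ : ∀ i, IsMarkovKernel (κ i) := fun i => by dsimp only [κ]; infer_instance
  have hdis : ∀ i, empirical (fun j => z j i) ⊗ₘ κ i = (γ i).map Prod.swap := fun i => by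
    rw [← map_empirical z (measurable_pi_apply i)]
    have h := ((γ i).map Prod.swap).disintegrate (κ i)
    rwa [Measure.fst, (swap_mem_pairCouplings (hγ i)).2.1] at h
  let Γ : Measure ((∀ i, X i) × (∀ i, X i)) :=
    (m : ℝ≥0∞)⁻¹ • ∑ j, (Measure.pi fun i => κ i (z j i)).map fun y => (y, z j)
  have hsnd : Γ.map Prod.snd = empirical z := by
    rw [map_smul_sum _ _ measurable_snd, empirical]
    congr 1
    refine Finset.sum_congr rfl fun j _ => ?_
    rw [Measure.map_map (by fun_prop) (by fun_prop)]
    simp [Function.comp_def, Measure.map_const]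
  have hΓ : IsProbabilityMeasure Γ := by
    have := isProbabilityMeasure_empirical hm z
    rw [← hsnd] at this
    exact Measure.isProbabilityMeasure_of_map Prod.snd
  have hpair : ∀ i, Γ.map (Prod.map (fun x => x i) (fun x => x i)) = γ i := fun i => by
    have h : ((γ i).map Prod.swap).map Prod.swap = γ i := by
      rw [Measure.map_map (by fun_prop) (by fun_prop)]
      simp
    rw [← h, ← hdis, empirical_compProd hm, map_smul_sum _ _ (by fun_prop),
      map_smul_sum _ _ (by fun_prop)]
    congr 1
    refine Finset.sum_congr rfl fun j _ => ?_
    -- The `i`-th marginal of the product of conditional laws is `κ i (z j i)`.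
    rw [← (measurePreserving_eval (fun i => κ i (z j i)) i).map_eq,
      Measure.map_map (by fun_prop) (by fun_prop), Measure.map_map (by fun_prop) (by fun_prop),
      Measure.map_map (by fun_prop) (by fun_prop)]
    rfl
  refine ⟨Γ.map Prod.fst, ⟨Measure.isProbabilityMeasure_map (by fun_prop), ?_⟩, Γ,
    ⟨hΓ, rfl, hsnd⟩, hpair⟩
  funext i
  rw [← (hγ i).2.1, ← hpair i, marginals, Measure.map_map (by fun_prop) (by fun_prop),
    Measure.map_map (by fun_prop) (by fun_prop)]
  rfl

theorem prodWasserstein_projection_le (hp : 1 ≤ p) {m : ℕ} (hm : 0 < m) (z : Fin m → ∀ i, X i)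
    {ν : ∀ i, Measure (X i)} [∀ i, IsProbabilityMeasure (ν i)] {π : Measure (∀ i, X i)}
    (hπ : IsProjection p (empirical z) ν π) :
    prodWasserstein p π (empirical z) ≤ vecWasserstein p ν (marginals (empirical z)) := by
  have := isProbabilityMeasure_empirical hm z
  have (i : Fin K) : IsProbabilityMeasure (marginals (empirical z) i) :=
    Measure.isProbabilityMeasure_map (measurable_pi_apply i).aemeasurable
  choose γ hγ hlim using fun i => exists_seq_tendsto_wassersteinWith
    (fun x y : X i => edist x y) p (ν i) (marginals (empirical z) i)
  -- By continuity of `lpCombine`, it suffices to bound the projection distance by the combined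
  -- coordinate costs at each `k`.
  refine ge_of_tendsto ((continuous_lpCombine (p := p).tendsto _).comp (tendsto_pi_nhds.2 hlim))
    (Eventually.of_forall fun k => ?_)
  obtain ⟨π', hπ', Γ, hΓ, hpair⟩ := exists_lift_coupling hm z fun i => hγ i k
  refine (hπ.2 π' hπ').trans ((wassersteinWith_le hΓ).trans_eq ?_)
  rw [eLpNorm_prodDist hp]
  simp only [hpair]
  rfl

end Product

/-- Stability of the optimal transport projection. The points `z j` of the product space are
the coupled data and the points `x i j` are the marginal data; the bounds hold for every
realization of the samples, and no moment assumption is needed because the distances take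
values in `[0, ∞]`. -/
theorem theorem3p1 {K : ℕ} {X : Fin K → Type*} [∀ i, MetricSpace (X i)]
    [∀ i, PolishSpace (X i)] [∀ i, MeasurableSpace (X i)] [∀ i, BorelSpace (X i)]
    (p : ℝ≥0∞) (hp : 1 ≤ p)
    (μ : ∀ i, Measure (X i)) (π₀ : Measure (∀ i, X i)) (hπ₀ : π₀ ∈ multiCouplings μ)
    (m n : ℕ) (hm : 0 < m) (hn : 0 < n)
    (z : Fin m → ∀ i, X i) (x : ∀ i, Fin n → X i)
    (πhat : Measure (∀ i, X i))
    (hπhat : IsProjection p (empirical z) (fun i => empirical (x i)) πhat) :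
    vecWasserstein p μ (fun i => empirical (x i)) ≤ prodWasserstein p πhat π₀ ∧
    prodWasserstein p πhat π₀ ≤
      vecWasserstein p (fun i => empirical (x i)) (marginals (empirical z)) +
        prodWasserstein p (empirical z) π₀ ∧
    prodWasserstein p πhat (empirical z) =
      vecWasserstein p (fun i => empirical (x i)) (marginals (empirical z)) := by
  obtain ⟨-, rfl⟩ := hπ₀
  have hmarg : marginals πhat = fun i => empirical (x i) := hπhat.1.2
  have (i : Fin K) : IsProbabilityMeasure (empirical (x i)) :=
    isProbabilityMeasure_empirical hn (x i)
  have hle := prodWasserstein_projection_le hp hm z hπhat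
  refine ⟨?_, ?_, le_antisymm hle ?_⟩
  · rw [vecWasserstein_comm, ← hmarg]
    exact vecWasserstein_marginals_le hp _ _
  · exact (wassersteinWith_triangle measurable_prodDist (prodDist_triangle hp) hp _ _ _).trans
      (add_le_add_left hle _)
  · rw [← hmarg]
    exact vecWasserstein_marginals_le hp _ _
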